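/- Let $g\ge 0$ and let $F_{2g}$ be a closed connected oriented surface of genus $2g$, written as the double of a surface of genus $g$ with one boundary circle. Let $\sigma_1$ be the corresponding smooth reflection, which fixes the gluing circle and interchanges the two halves. Let $S(v)\subset\mathbb R^3$ be the unit sphere and let $M_{2g}=(F_{2g}\times S(v))/\sigma$ with $\sigma(f,w)=(\sigma_1(f),-w)$. The group $SU(2)=Sp(1)$ acts on $M_{2g}$ trivially on the factor $F_{2g}$ and through $SU(2)\to SO(3)$ on $S(v)$. Fix an $SU(2)$-invariant Riemannian metric and a spin structure on $M_{2g}$. The action lifts to the spin structure and hence to the spinor bundles $\Delta^{\pm}$, regarded as principal $SU(2)$-bundles over $M_{2g}$. Let $m=[f_0,e_0]$ with $\sigma_1(f_0)=f_0$ and $e_0=(1,0,0)$. Let $\eta$ be either of the bundles $\Delta^+$, $\Delta^-$. Let $\mathcal A_{SU(2)}$ be the space of smooth $SU(2)$-invariant connections on $\eta$, with the topology induced from any fixed Sobolev or Morrey norm $L^{k,p}_\lambda$ ($k\in\mathbb N$, $1\le p<\infty$, $0\le\lambda\le 4$; $\lambda=4$ gives the Sobolev norm $L^{k,p}$). Let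 $\mathcal G_{SU(2)}$ be the group of smooth gauge transformations of $\eta$ that commute with the $SU(2)$-action, and let $\mathcal G^0_{SU(2)}$ be the subgroup of those that are the identity on the fibre over $m$. Both groups act on $\mathcal A_{SU(2)}$ by pull back. Give the orbit spaces $\mathcal B_{SU(2)}=\mathcal A_{SU(2)}/\mathcal G_{SU(2)}$ and $\mathcal B^0_{SU(2)}=\mathcal A_{SU(2)}/\mathcal G^0_{SU(2)}$ the quotient topologies. Then $\mathcal G^0_{SU(2)}$ is a normal subgroup of $\mathcal G_{SU(2)}$ with $\mathcal G_{SU(2)}/\mathcal G^0_{SU(2)}\cong\mathbb Z_2$, and the natural projection $$\pi:\mathcal B^0_{SU(2)}\longrightarrow\mathcal B_{SU(2)}$$ is a homeomorphism. -/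

import Mathlib

open Set Function MeasureTheory
open scoped Manifold ContDiff ENNReal Quaternion

noncomputable section

/-! ## The group `SU(2) = Sp(1)`, the spheres and the rotation action -/

/-- The quaternions form a four-dimensional Euclidean space. -/
instance factFinrankQuaternion : Fact (Module.finrank ℝ ℍ[ℝ] = 3 + 1) :=
  ⟨by rw [Quaternion.finrank_eq_four]⟩

/-- `SU(2) = Sp(1)`, the group of unit quaternions, with its smooth structure as the unit
three-sphere. -/
abbrev SU2 : Type := Metric.sphere (0 : ℍ[ℝ]) 1

/-- `Spin(4) = Sp(1) × Sp(1)`. -/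
abbrev Spin4 : Type := SU2 × SU2

/-- The model with corners of `Spin(4)`. -/
abbrev modelSpin4 := (𝓡 3).prod (𝓡 3)

/-- The unit sphere `S(v)` of the standard representation `v = ℝ³` of `SO(3)`. -/
abbrev S2 : Type := Metric.sphere (0 : EuclideanSpace ℝ (Fin 3)) 1

/-- The identification of `ℝ³` with the imaginary quaternions. -/
def imQuat (x : EuclideanSpace ℝ (Fin 3)) : ℍ[ℝ] := ⟨0, x 0, x 1, x 2⟩

/-- The inverse identification (forgetting the real part). -/
def imPart (a : ℍ[ℝ]) : EuclideanSpace ℝ (Fin 3) := !₂[a.imI, a.imJ, a.imK]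

theorem imPart_imQuat (x : EuclideanSpace ℝ (Fin 3)) : imPart (imQuat x) = x := by
  ext i; fin_cases i <;> simp [imPart, imQuat]

theorem imQuat_imPart {a : ℍ[ℝ]} (ha : a.re = 0) : imQuat (imPart a) = a := by
  ext <;> simp [imPart, imQuat, ha]

theorem norm_imQuat (x : EuclideanSpace ℝ (Fin 3)) : ‖imQuat x‖ = ‖x‖ := by
  have h : ‖imQuat x‖ ^ 2 = ‖x‖ ^ 2 := by
    rw [EuclideanSpace.norm_sq_eq, Fin.sum_univ_three, sq, ← Quaternion.normSq_eq_norm_mul_self,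
      Quaternion.normSq_def']
    simp [imQuat]
  exact (sq_eq_sq₀ (norm_nonneg _) (norm_nonneg _)).1 h

theorem re_conj (a b : ℍ[ℝ]) (hb : b.re = 0) : (a * b * star a).re = 0 := by
  simp only [Quaternion.re_mul, Quaternion.imI_mul, Quaternion.imJ_mul,
    Quaternion.imK_mul, Quaternion.re_star, Quaternion.imI_star, Quaternion.imJ_star,
    Quaternion.imK_star, hb]
  ring

theorem re_conj_imQuat (h : ℍ[ℝ]) (x : EuclideanSpace ℝ (Fin 3)) :
    (h * imQuat x * star h).re = 0 :=
  re_conj h _ rfl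

/-- The standard action of `SU(2)` on `S(v)` through the double cover `SU(2) → SO(3)`: a unit
quaternion `h` sends an imaginary quaternion `w` to `h w h⁻¹`, where `h⁻¹` is the conjugate
of `h`. -/
instance rotationAction : MulAction SU2 S2 where
  smul h w := ⟨imPart (h * imQuat w * star (h : ℍ[ℝ])), by
    have hh : ‖(h : ℍ[ℝ])‖ = 1 := by simp
    have hw : ‖(w : EuclideanSpace ℝ (Fin 3))‖ = 1 := by simp
    rw [mem_sphere_zero_iff_norm, ← norm_imQuat, imQuat_imPart (re_conj_imQuat _ _), norm_mul,
      norm_mul, norm_star, norm_imQuat, hh, hw]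
    norm_num⟩
  one_smul w := Subtype.ext <| by
    change imPart (((1 : SU2) : ℍ[ℝ]) * imQuat w * star ((1 : SU2) : ℍ[ℝ])) = w
    simp [imPart_imQuat]
  mul_smul a b w := Subtype.ext <| by
    change imPart (((a * b : SU2) : ℍ[ℝ]) * imQuat w * star ((a * b : SU2) : ℍ[ℝ])) =
      imPart (a * imQuat (imPart (b * imQuat w * star (b : ℍ[ℝ]))) * star (a : ℍ[ℝ]))
    rw [imQuat_imPart (re_conj_imQuat _ _)]
    simp [mul_assoc]

/-- The point `e₀ = (1,0,0)` of `S(v)`. -/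
def e0 : S2 := ⟨EuclideanSpace.single 0 1, by simp⟩

/-! ## The surface `F_{2g}`, its reflection, and the four-manifold `M_{2g}` -/

/-- `HasGenus F k`: the first integral homology group `H₁(F; ℤ) = π₁(F)ᵃᵇ` is free abelian of
rank `2 k`. For a closed connected surface `F` this says exactly that `F` is orientable of genus
`k` (the first homology of a non-orientable closed surface has torsion). -/
def HasGenus (F : Type*) [TopologicalSpace F] (k : ℕ) : Prop :=
  ∀ x : F, Nonempty (Abelianization (FundamentalGroup F x) ≃* Multiplicative (Fin (2 * k) → ℤ))

/-- `σ₁` is the reflection of a surface which is the double of a surface with one boundary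
circle: it is a smooth involution, its fixed point set is a circle, and the complement of this
circle consists of two connected halves interchanged by `σ₁`. If `F` is a closed connected
oriented surface of genus `2 g`, then each half is a surface of genus `g` with a closed disc
removed, and `σ₁` reverses the orientation. -/
structure IsReflection {F : Type*} [TopologicalSpace F]
    [ChartedSpace (EuclideanSpace ℝ (Fin 2)) F] (σ₁ : F → F) : Prop where
  smooth : ContMDiff (𝓡 2) (𝓡 2) ∞ σ₁
  involutive : Involutive σ₁
  circle : Nonempty (fixedPoints σ₁ ≃ₜ Circle)
  halves : ∃ U : Set F, IsOpen U ∧ IsConnected U ∧ Disjoint U (σ₁ '' U) ∧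
    U ∪ σ₁ '' U = (fixedPoints σ₁)ᶜ

/-- `M`, with its action of `SU(2)`, is the smooth quotient of `F × S(v)` by the free involution
`σ (f, w) = (σ₁ f, -w)`, with projection `q`; the group acts trivially on `F` and by rotations
on `S(v)`. These properties determine the manifold `M` and the action up to a unique equivariant
diffeomorphism compatible with the projections. -/
structure IsTwistedProduct {F M : Type*} [TopologicalSpace F]
    [ChartedSpace (EuclideanSpace ℝ (Fin 2)) F] [TopologicalSpace M]
    [ChartedSpace (EuclideanSpace ℝ (Fin 4)) M] [MulAction SU2 M]
    (σ₁ : F → F) (q : F × S2 → M) : Prop where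
  localDiffeo : IsLocalDiffeomorph ((𝓡 2).prod (𝓡 2)) (𝓡 4) ∞ q
  surjective : Surjective q
  eq_iff : ∀ x y : F × S2, q x = q y ↔ y = x ∨ y = (σ₁ x.1, -x.2)
  smul : ∀ (h : SU2) (f : F) (w : S2), q (f, h • w) = h • q (f, w)

/-! ## Equivariant principal bundles

A right action of a group `G` is an action of the opposite group: `p · g` is written
`MulOpposite.op g • p`. -/

/-- `π : P → M` is a smooth principal `G`-bundle for the given right action of `G` on `P`. -/
structure IsPrincipalBundle {EG HG EP HP EM HM : Type*}
    [NormedAddCommGroup EG] [NormedSpace ℝ EG] [TopologicalSpace HG]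
    [NormedAddCommGroup EP] [NormedSpace ℝ EP] [TopologicalSpace HP]
    [NormedAddCommGroup EM] [NormedSpace ℝ EM] [TopologicalSpace HM]
    (IG : ModelWithCorners ℝ EG HG) (IP : ModelWithCorners ℝ EP HP)
    (IM : ModelWithCorners ℝ EM HM)
    (G : Type*) [TopologicalSpace G] [ChartedSpace HG G] [Group G]
    {P M : Type*} [TopologicalSpace P] [ChartedSpace HP P] [TopologicalSpace M]
    [ChartedSpace HM M] [MulAction Gᵐᵒᵖ P] (π : P → M) : Prop where
  smooth_proj : ContMDiff IP IM ∞ π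
  smooth_act : ContMDiff (IP.prod IG) IP ∞ (fun x : P × G => MulOpposite.op x.2 • x.1)
  proj_act : ∀ (p : P) (g : G), π (MulOpposite.op g • p) = π p
  locally_trivial : ∀ x : M, ∃ e : Bundle.Trivialization G π, x ∈ e.baseSet ∧
    ContMDiffOn IP (IM.prod IG) ∞ e e.source ∧
    ContMDiffOn (IM.prod IG) IP ∞ e.toOpenPartialHomeomorph.symm e.target ∧
    ∀ p ∈ e.source, ∀ g : G, e (MulOpposite.op g • p) = ((e p).1, (e p).2 * g)

/-- The principal `G`-bundle `π : P → M` is `H`-equivariant: `H` acts smoothly on `P`, the action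
commutes with the right action of `G` and covers the action of `H` on `M`. -/
structure IsEquivariantPrincipalBundle {EG HG EP HP EM HM EK HK : Type*}
    [NormedAddCommGroup EG] [NormedSpace ℝ EG] [TopologicalSpace HG]
    [NormedAddCommGroup EP] [NormedSpace ℝ EP] [TopologicalSpace HP]
    [NormedAddCommGroup EM] [NormedSpace ℝ EM] [TopologicalSpace HM]
    [NormedAddCommGroup EK] [NormedSpace ℝ EK] [TopologicalSpace HK]
    (IG : ModelWithCorners ℝ EG HG) (IP : ModelWithCorners ℝ EP HP)
    (IM : ModelWithCorners ℝ EM HM) (IK : ModelWithCorners ℝ EK HK)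
    (G : Type*) [TopologicalSpace G] [ChartedSpace HG G] [Group G]
    (H : Type*) [TopologicalSpace H] [ChartedSpace HK H] [Group H]
    {P M : Type*} [TopologicalSpace P] [ChartedSpace HP P] [TopologicalSpace M]
    [ChartedSpace HM M] [MulAction Gᵐᵒᵖ P] [MulAction H P] [MulAction H M]
    (π : P → M) : Prop extends IsPrincipalBundle IG IP IM G π where
  smooth_left : ContMDiff (IK.prod IP) IP ∞ (fun x : H × P => x.1 • x.2)
  proj_left : ∀ (h : H) (p : P), π (h • p) = h • π p
  comm : ∀ (h : H) (g : G) (p : P), h • MulOpposite.op g • p = MulOpposite.op g • h • p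

/-- An `SU(2)`-equivariant principal `Spin(4)`-bundle over a four-manifold. -/
abbrev IsEquivariantSpin4Bundle {Q M : Type*} [TopologicalSpace Q]
    [ChartedSpace (EuclideanSpace ℝ (Fin 10)) Q] [TopologicalSpace M]
    [ChartedSpace (EuclideanSpace ℝ (Fin 4)) M] [MulAction Spin4ᵐᵒᵖ Q] [MulAction SU2 Q]
    [MulAction SU2 M] (π : Q → M) : Prop :=
  IsEquivariantPrincipalBundle modelSpin4 (𝓡 10) (𝓡 4) (𝓡 3) Spin4 SU2 π

/-- An `SU(2)`-equivariant principal `SU(2)`-bundle over a four-manifold. -/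
class IsEquivariantSU2Bundle {P M : Type*} [TopologicalSpace P]
    [ChartedSpace (EuclideanSpace ℝ (Fin 7)) P] [TopologicalSpace M]
    [ChartedSpace (EuclideanSpace ℝ (Fin 4)) M] [MulAction SU2ᵐᵒᵖ P] [MulAction SU2 P]
    [MulAction SU2 M] (π : P → M) : Prop where
  out : IsEquivariantPrincipalBundle (𝓡 3) (𝓡 7) (𝓡 4) (𝓡 3) SU2 SU2 π

/-! ## Spin structures and spinor bundles -/

/-- A smooth Riemannian metric on a four-manifold. -/
abbrev Metric4 (M : Type*) [TopologicalSpace M] [ChartedSpace (EuclideanSpace ℝ (Fin 4)) M]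
    [IsManifold (𝓡 4) ∞ M] : Type _ :=
  Bundle.ContMDiffRiemannianMetric (𝓡 4) ∞ (EuclideanSpace ℝ (Fin 4))
    (fun x : M => TangentSpace (𝓡 4) x)

/-- The metric `γ` is invariant under the action of `SU(2)`. -/
def IsInvariantMetric {M : Type*} [TopologicalSpace M]
    [ChartedSpace (EuclideanSpace ℝ (Fin 4)) M] [IsManifold (𝓡 4) ∞ M] [MulAction SU2 M]
    (γ : Metric4 M) : Prop :=
  ∀ (h : SU2) (x : M) (v w : TangentSpace (𝓡 4) x),
    γ.inner (h • x) (mfderiv (𝓡 4) (𝓡 4) (fun y : M => h • y) x v)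
      (mfderiv (𝓡 4) (𝓡 4) (fun y : M => h • y) x w) = γ.inner x v w

/-- The `SU(2)`-equivariant principal `Spin(4)`-bundle `π : Q → M` and the map `e` form an
`SU(2)`-equivariant spin structure of the Riemannian four-manifold `(M, γ)`. Here `e` sends a
point `y` of `Q` to an orthonormal frame of the tangent space at `π y`, a linear isometry from
`ℝ⁴ = ℍ`; it is equivariant along the double cover `Spin(4) → SO(4)` that sends `(a, b)` to
`x ↦ a x b⁻¹`, and the action of `SU(2)` on `Q` covers the action on frames by differentials.
The orientation of `M` is the one that makes these frames oriented. -/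
structure IsSpinStructure {Q M : Type*} [TopologicalSpace Q]
    [ChartedSpace (EuclideanSpace ℝ (Fin 10)) Q] [TopologicalSpace M]
    [ChartedSpace (EuclideanSpace ℝ (Fin 4)) M] [IsManifold (𝓡 4) ∞ M]
    [MulAction Spin4ᵐᵒᵖ Q] [MulAction SU2 Q] [MulAction SU2 M] (γ : Metric4 M) (π : Q → M)
    (e : ∀ y : Q, ℍ[ℝ] →L[ℝ] TangentSpace (𝓡 4) (π y)) : Prop where
  bundle : IsEquivariantSpin4Bundle π
  smooth : ContMDiff ((𝓡 10).prod 𝓘(ℝ, ℍ[ℝ])) (𝓡 4).tangent ∞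
    (fun z : Q × ℍ[ℝ] => (⟨π z.1, e z.1 z.2⟩ : TangentBundle (𝓡 4) M))
  isometry : ∀ (y : Q) (u v : ℍ[ℝ]), γ.inner (π y) (e y u) (e y v) = inner ℝ u v
  equivariant : ∀ (y : Q) (a b : SU2) (u : ℍ[ℝ]),
    (⟨π (MulOpposite.op (a, b) • y), e (MulOpposite.op (a, b) • y) u⟩ : TangentBundle (𝓡 4) M) =
      ⟨π y, e y ((a : ℍ[ℝ]) * u * (b : ℍ[ℝ])⁻¹)⟩
  lift : ∀ (h : SU2) (y : Q) (u : ℍ[ℝ]),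
    (⟨π (h • y), e (h • y) u⟩ : TangentBundle (𝓡 4) M) =
      tangentMap (𝓡 4) (𝓡 4) (fun x : M => h • x) ⟨π y, e y u⟩

/-- The two chiralities of spinors. -/
inductive Chirality
  | plus
  | minus

/-- The half-spin representations `Spin(4) → SU(2)`: the two projections. -/
def halfSpin : Chirality → (Spin4 →* SU2)
  | .plus => MonoidHom.fst SU2 SU2
  | .minus => MonoidHom.snd SU2 SU2

/-- The `SU(2)`-equivariant principal `SU(2)`-bundle `πP : P → M` is, through the map
`r : Q → P`, the bundle associated with the spin structure `πQ : Q → M` by the half-spin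
representation of chirality `c`; that is, it is the spinor bundle `Δ⁺` or `Δ⁻`, viewed as a
principal bundle. Such a pair `(P, r)` is unique up to a unique equivariant isomorphism. -/
structure IsSpinorBundle {Q P M : Type*} [TopologicalSpace Q]
    [ChartedSpace (EuclideanSpace ℝ (Fin 10)) Q] [TopologicalSpace P]
    [ChartedSpace (EuclideanSpace ℝ (Fin 7)) P] [TopologicalSpace M]
    [ChartedSpace (EuclideanSpace ℝ (Fin 4)) M] [MulAction Spin4ᵐᵒᵖ Q] [MulAction SU2 Q]
    [MulAction SU2ᵐᵒᵖ P] [MulAction SU2 P]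
    (c : Chirality) (πQ : Q → M) (πP : P → M) (r : Q → P) : Prop where
  smooth : ContMDiff (𝓡 10) (𝓡 7) ∞ r
  proj : ∀ y : Q, πP (r y) = πQ y
  right : ∀ (s : Spin4) (y : Q), r (MulOpposite.op s • y) = MulOpposite.op (halfSpin c s) • r y
  left : ∀ (h : SU2) (y : Q), r (h • y) = h • r y

/-! ## Invariant gauge groups and invariant connections -/

section Gauge

variable {P M : Type*} [TopologicalSpace P] [ChartedSpace (EuclideanSpace ℝ (Fin 7)) P]
  [TopologicalSpace M] [ChartedSpace (EuclideanSpace ℝ (Fin 4)) M]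
  [MulAction SU2ᵐᵒᵖ P] [MulAction SU2 P] [MulAction SU2 M]

/-- The invariant gauge group: the smooth automorphisms of the principal bundle `π : P → M` over
the identity of `M` which commute with the left action of `SU(2)` on `P`. -/
def invariantGaugeGroup (π : P → M) : Subgroup (Equiv.Perm P) where
  carrier := {φ | ContMDiff (𝓡 7) (𝓡 7) ∞ φ ∧ ContMDiff (𝓡 7) (𝓡 7) ∞ φ.symm ∧
    (∀ p, π (φ p) = π p) ∧
    (∀ (g : SU2) (p : P), φ (MulOpposite.op g • p) = MulOpposite.op g • φ p) ∧
    (∀ (h : SU2) (p : P), φ (h • p) = h • φ p)}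
  mul_mem' := by
    rintro φ ψ ⟨h1, h2, h3, h4, h5⟩ ⟨k1, k2, k3, k4, k5⟩
    exact ⟨h1.comp k1, k2.comp h2, fun p => by simp [h3, k3], fun g p => by simp [h4, k4],
      fun h p => by simp [h5, k5]⟩
  one_mem' := ⟨contMDiff_id, contMDiff_id, fun _ => rfl, fun _ _ => rfl, fun _ _ => rfl⟩
  inv_mem' := by
    rintro φ ⟨h1, h2, h3, h4, h5⟩
    refine ⟨h2, h1, fun p => ?_, fun g p => ?_, fun h p => ?_⟩
    · have := h3 (φ⁻¹ p); simpa using this.symm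
    · apply φ.injective; simp [h4]
    · apply φ.injective; simp [h5]

/-- The based invariant gauge group: the invariant gauge transformations which are the identity
on the fibre over the base point `m`. -/
def basedGaugeGroup (π : P → M) (m : M) : Subgroup (invariantGaugeGroup π) where
  carrier := {φ | ∀ p, π p = m → (φ : Equiv.Perm P) p = p}
  mul_mem' := by
    intro φ ψ hφ hψ p hp
    simp [hψ p hp, hφ p hp]
  one_mem' := fun _ _ => rfl
  inv_mem' := by
    intro φ hφ p hp
    have := hφ p hp
    change (φ : Equiv.Perm P)⁻¹ p = p
    rw [Equiv.Perm.inv_eq_iff_eq, this]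

instance basedGaugeGroup_normal (π : P → M) (m : M) : (basedGaugeGroup π m).Normal where
  conj_mem := by
    intro φ hφ ψ p hp
    have h1 : π ((ψ : Equiv.Perm P)⁻¹ p) = m := by
      rw [← hp]; exact (ψ⁻¹).2.2.2.1 p
    have h2 : (φ : Equiv.Perm P) ((ψ : Equiv.Perm P)⁻¹ p) = (ψ : Equiv.Perm P)⁻¹ p := hφ _ h1
    change (ψ : Equiv.Perm P) ((φ : Equiv.Perm P) ((ψ : Equiv.Perm P)⁻¹ p)) = p
    rw [h2]; simp

namespace InvariantConnection

theorem mdiff_right (π : P → M) [hπ : IsEquivariantSU2Bundle π] (g : SU2) :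
    ContMDiff (𝓡 7) (𝓡 7) ∞ (fun x : P => MulOpposite.op g • x) :=
  hπ.out.smooth_act.comp (contMDiff_id.prodMk contMDiff_const)

theorem mdiff_left (π : P → M) [hπ : IsEquivariantSU2Bundle π] (h : SU2) :
    ContMDiff (𝓡 7) (𝓡 7) ∞ (fun x : P => h • x) :=
  hπ.out.smooth_left.comp (contMDiff_const.prodMk contMDiff_id)

theorem mdiff_orbit (π : P → M) [hπ : IsEquivariantSU2Bundle π] (p : P) :
    ContMDiff (𝓡 3) (𝓡 7) ∞ (fun g : SU2 => MulOpposite.op g • p) :=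
  hπ.out.smooth_act.comp (contMDiff_const.prodMk contMDiff_id)

end InvariantConnection

variable [IsManifold (𝓡 7) ∞ P]

variable (P) in
/-- An `SU(2)`-invariant smooth connection on the principal bundle with total space `P`: a
smooth one-form on `P` with values in `su(2)`, the imaginary quaternions, which transforms by
the adjoint action under the right action of the structure group, reproduces the generators of
vertical vectors (`SU(2)` lies in `ℍ`, and the differential of the inclusion at `1` identifies
the tangent space there with `su(2)`), and is fixed by pull back under the left action of
`SU(2)`. -/
@[ext]
structure InvariantConnection where
  form : ∀ p : P, TangentSpace (𝓡 7) p →L[ℝ] ℍ[ℝ]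
  smooth : ContMDiff (𝓡 7).tangent 𝓘(ℝ, ℍ[ℝ]) ∞
    (fun v : TangentBundle (𝓡 7) P => form v.1 v.2)
  re_eq_zero : ∀ (p : P) (v : TangentSpace (𝓡 7) p), (form p v).re = 0
  adjoint : ∀ (g : SU2) (p : P) (v : TangentSpace (𝓡 7) p),
    form (MulOpposite.op g • p)
        (mfderiv (𝓡 7) (𝓡 7) (fun x : P => MulOpposite.op g • x) p v) =
      (g : ℍ[ℝ])⁻¹ * form p v * (g : ℍ[ℝ])
  vertical : ∀ (p : P) (ξ : TangentSpace (𝓡 3) (1 : SU2)),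
    form (MulOpposite.op (1 : SU2) • p)
        (mfderiv (𝓡 3) (𝓡 7) (fun g : SU2 => MulOpposite.op g • p) 1 ξ) =
      mfderiv (𝓡 3) 𝓘(ℝ, ℍ[ℝ]) (fun g : SU2 => (g : ℍ[ℝ])) 1 ξ
  invariant : ∀ (h : SU2) (p : P) (v : TangentSpace (𝓡 7) p),
    form (h • p) (mfderiv (𝓡 7) (𝓡 7) (fun x : P => h • x) p v) = form p v

namespace InvariantConnection

/-- The pull back `φ^* A` of a connection by a gauge transformation. -/
def pullback (π : P → M) [IsEquivariantSU2Bundle π] (φ : invariantGaugeGroup π)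
    (A : InvariantConnection P) : InvariantConnection P where
  form p := (A.form ((φ : Equiv.Perm P) p)).comp
    (mfderiv (𝓡 7) (𝓡 7) (φ : Equiv.Perm P) p)
  smooth := A.smooth.comp (φ.2.1.contMDiff_tangentMap (m := ∞) le_rfl)
  re_eq_zero p v := A.re_eq_zero _ _
  adjoint g p v := by
    have hφ : MDifferentiable (𝓡 7) (𝓡 7) (φ : Equiv.Perm P) := φ.2.1.mdifferentiable (by simp)
    have hg : MDifferentiable (𝓡 7) (𝓡 7) (fun x : P => MulOpposite.op g • x) :=
      (mdiff_right π g).mdifferentiable (by simp)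
    have h1 := tangentMap_comp_at (I := 𝓡 7) (I' := 𝓡 7) (I'' := 𝓡 7) ⟨p, v⟩ (hφ _) (hg p)
    have h2 := tangentMap_comp_at (I := 𝓡 7) (I' := 𝓡 7) (I'' := 𝓡 7) ⟨p, v⟩ (hg _) (hφ p)
    have h3 : (φ : Equiv.Perm P) ∘ (fun x : P => MulOpposite.op g • x) =
        (fun x : P => MulOpposite.op g • x) ∘ (φ : Equiv.Perm P) :=
      funext fun x => φ.2.2.2.2.1 g x
    rw [h3, h2] at h1
    exact (congrArg (fun z : TangentBundle (𝓡 7) P => A.form z.1 z.2) h1).symm.trans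
      (A.adjoint g _ _)
  vertical p ξ := by
    have hφ : MDifferentiable (𝓡 7) (𝓡 7) (φ : Equiv.Perm P) := φ.2.1.mdifferentiable (by simp)
    have hp : MDifferentiable (𝓡 3) (𝓡 7) (fun g : SU2 => MulOpposite.op g • p) :=
      (mdiff_orbit π p).mdifferentiable (by simp)
    have h1 := tangentMap_comp_at (I := 𝓡 3) (I' := 𝓡 7) (I'' := 𝓡 7) ⟨1, ξ⟩ (hφ _) (hp 1)
    have h3 : (φ : Equiv.Perm P) ∘ (fun g : SU2 => MulOpposite.op g • p) =
        (fun g : SU2 => MulOpposite.op g • (φ : Equiv.Perm P) p) :=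
      funext fun x => φ.2.2.2.2.1 x p
    rw [h3] at h1
    exact (congrArg (fun z : TangentBundle (𝓡 7) P => A.form z.1 z.2) h1).symm.trans
      (A.vertical _ _)
  invariant h p v := by
    have hφ : MDifferentiable (𝓡 7) (𝓡 7) (φ : Equiv.Perm P) := φ.2.1.mdifferentiable (by simp)
    have hh : MDifferentiable (𝓡 7) (𝓡 7) (fun x : P => h • x) :=
      (mdiff_left π h).mdifferentiable (by simp)
    have h1 := tangentMap_comp_at (I := 𝓡 7) (I' := 𝓡 7) (I'' := 𝓡 7) ⟨p, v⟩ (hφ _) (hh p)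
    have h2 := tangentMap_comp_at (I := 𝓡 7) (I' := 𝓡 7) (I'' := 𝓡 7) ⟨p, v⟩ (hh _) (hφ p)
    have h3 : (φ : Equiv.Perm P) ∘ (fun x : P => h • x) =
        (fun x : P => h • x) ∘ (φ : Equiv.Perm P) :=
      funext fun x => φ.2.2.2.2.2 h x
    rw [h3, h2] at h1
    exact (congrArg (fun z : TangentBundle (𝓡 7) P => A.form z.1 z.2) h1).symm.trans
      (A.invariant h _ _)

end InvariantConnection

/-- The invariant gauge group acts on invariant connections from the right by pull back. -/
instance gaugeAction (π : P → M) [IsEquivariantSU2Bundle π] :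
    MulAction (invariantGaugeGroup π)ᵐᵒᵖ (InvariantConnection P) where
  smul φ A := A.pullback π φ.unop
  one_smul A := by
    change A.pullback π 1 = A
    ext p : 2
    change (A.form p).comp (mfderiv (𝓡 7) (𝓡 7) (id : P → P) p) = A.form p
    rw [mfderiv_id]
    exact ContinuousLinearMap.comp_id _
  mul_smul φ ψ A := by
    change A.pullback π (ψ.unop * φ.unop) = (A.pullback π ψ.unop).pullback π φ.unop
    ext p : 2
    have h1 : MDifferentiable (𝓡 7) (𝓡 7) (φ.unop : Equiv.Perm P) :=
      φ.unop.2.1.mdifferentiable (by simp)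
    have h2 : MDifferentiable (𝓡 7) (𝓡 7) (ψ.unop : Equiv.Perm P) :=
      ψ.unop.2.1.mdifferentiable (by simp)
    change (A.form _).comp (mfderiv (𝓡 7) (𝓡 7)
      ((ψ.unop : Equiv.Perm P) ∘ (φ.unop : Equiv.Perm P)) p) = _
    rw [mfderiv_comp p (h2 _) (h1 p)]
    rfl

/-! ## Sobolev and Morrey topologies -/

/-- A local frame of `π : P → M`: a smooth map `s` from an open set of `ℝ⁴` to `P` such that
`π ∘ s` is a diffeomorphism onto an open subset of `M`. In other words: a chart of `M` together
with a local section of `P`, that is a local trivialization, over its domain. -/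
structure LocalFrame (π : P → M) where
  dom : Set (EuclideanSpace ℝ (Fin 4))
  isOpen_dom : IsOpen dom
  s : EuclideanSpace ℝ (Fin 4) → P
  smooth : ContMDiffOn (𝓡 4) (𝓡 7) ∞ s dom
  injOn : InjOn (π ∘ s) dom
  localDiffeo : IsLocalDiffeomorphOn (𝓡 4) (𝓡 4) ∞ (π ∘ s) dom

/-- The connection form in a local frame: the `su(2)`-valued one-form `s^* A` on an open set
of `ℝ⁴`. -/
def localForm (A : InvariantConnection P) (s : EuclideanSpace ℝ (Fin 4) → P)
    (x : EuclideanSpace ℝ (Fin 4)) : EuclideanSpace ℝ (Fin 4) →L[ℝ] ℍ[ℝ] :=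
  (A.form (s x)).comp (mfderiv (𝓡 4) (𝓡 7) s x)

/-- The norm of the Morrey space `L^p_λ` on a subset `K` of `ℝ⁴`: the sum of the norm of
`L^p (K)` and of the supremum of `ρ ^ ((λ - 4) / p) ‖f‖` over the balls of radius `ρ ≤ 1`, where
the norm is that of `L^p` of the intersection of `K` with the ball. For `λ = 4` it is equivalent
to the norm of `L^p (K)`. -/
def morreyNorm {V : Type*} [NormedAddCommGroup V] (p lam : ℝ)
    (K : Set (EuclideanSpace ℝ (Fin 4))) (f : EuclideanSpace ℝ (Fin 4) → V) : ℝ≥0∞ :=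
  eLpNorm f (ENNReal.ofReal p) (volume.restrict K) +
    ⨆ (x : EuclideanSpace ℝ (Fin 4)) (ρ ∈ Ioc (0 : ℝ) 1),
      ENNReal.ofReal (ρ ^ ((lam - 4) / p)) *
        eLpNorm f (ENNReal.ofReal p) (volume.restrict (K ∩ Metric.ball x ρ))

/-- The distance of two connections in the seminorm given by the `j`-th derivatives of the
local connection forms in the frame `s` over the set `K`. -/
def morreyDist (p lam : ℝ) {π : P → M} (s : LocalFrame π)
    (K : Set (EuclideanSpace ℝ (Fin 4))) (j : ℕ) (A B : InvariantConnection P) : ℝ≥0∞ :=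
  morreyNorm p lam K
    (iteratedFDeriv ℝ j (fun x => localForm A s.s x - localForm B s.s x))

/-- The topology on invariant connections induced from the norm of `L^{k,p}_λ`: it is generated
by the balls of the seminorms given by the derivatives of order at most `k` of the local
connection forms, over compact subsets of the domains of local frames. As `M` is compact,
finitely many frames and compact sets suffice. For `λ = 4` this is the topology of the Sobolev
space `L^{k,p}`. -/
@[reducible] def morreyTopology (π : P → M) (k : ℕ) (p lam : ℝ) :
    TopologicalSpace (InvariantConnection P) :=
  TopologicalSpace.generateFrom
    {U | ∃ (s : LocalFrame π) (K : Set (EuclideanSpace ℝ (Fin 4))) (j : ℕ)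
      (A : InvariantConnection P) (ε : ℝ≥0∞), IsCompact K ∧ K ⊆ s.dom ∧ j ≤ k ∧ 0 < ε ∧
        U = {B | morreyDist p lam s K j A B < ε}}

/-! ## Orbit spaces -/

/-- The invariant orbit space: invariant connections modulo the invariant gauge group. -/
abbrev OrbitSpace (π : P → M) [IsEquivariantSU2Bundle π] : Type _ :=
  MulAction.orbitRel.Quotient (invariantGaugeGroup π)ᵐᵒᵖ (InvariantConnection P)

/-- The based invariant orbit space: invariant connections modulo the based invariant gauge
group. -/
abbrev BasedOrbitSpace (π : P → M) [IsEquivariantSU2Bundle π] (m : M) : Type _ :=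
  MulAction.orbitRel.Quotient (basedGaugeGroup π m).op (InvariantConnection P)

/-- The quotient topology on the invariant orbit space. -/
@[reducible] def orbitTopology (π : P → M) [IsEquivariantSU2Bundle π] (k : ℕ) (p lam : ℝ) :
    TopologicalSpace (OrbitSpace π) :=
  letI := morreyTopology π k p lam
  (inferInstance : TopologicalSpace (Quotient _))

/-- The quotient topology on the based invariant orbit space. -/
@[reducible] def basedOrbitTopology (π : P → M) [IsEquivariantSU2Bundle π] (m : M) (k : ℕ) (p lam : ℝ) :
    TopologicalSpace (BasedOrbitSpace π m) :=
  letI := morreyTopology π k p lam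
  (inferInstance : TopologicalSpace (Quotient _))

/-- The natural projection from the based invariant orbit space to the invariant orbit space. -/
def orbitProj (π : P → M) [IsEquivariantSU2Bundle π] (m : M) :
    BasedOrbitSpace π m → OrbitSpace π :=
  Quotient.map' id (by
    rintro A B ⟨φ, hφ⟩
    exact ⟨φ.1, hφ⟩)

end Gauge

end

noncomputable section

/-! Over `m = [f₀, e₀]` an invariant gauge transformation has to commute with the isotropy
representation, and that representation is irreducible, so only `±1` remains. The stabiliser of `m`
contains `i`, which fixes `e₀`, and `j`, which sends `e₀` to `-e₀`, because `[f₀, -e₀] = [f₀, e₀]`.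
In the fibre of the spin structure over `m` they act as elements `s`, `t` of `Spin(4)`. Since `-1`
acts trivially on `M`, `s²` lies in the kernel `±(1, 1)` of `Spin(4) → SO(4)`. If `s² = (1, 1)`,
both components of `s` are `±1` and the differential of `i` at `m` is a scalar; but it is the
identity along `F` and not along `S(v)`. Hence `s² = (-1, -1)`, and `ij = (-1)ji` makes the
components of `s` and `t` anticommute (`exists_anticommuting`). A gauge transformation moves a point
over `m` by some `u` that commutes with two anticommuting unit quaternions, so `u = ±1`. The
constant gauge transformation `-1` realises the sign, so the based group has index two. As `-1` is
central it fixes every connection; the orbits of the two groups therefore coincide, and so do the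
quotient topologies. -/

/-! ### Quaternion units and their rotations of the sphere -/

theorem re_imQuat (x : EuclideanSpace ℝ (Fin 3)) : (imQuat x).re = 0 := rfl

theorem imI_imQuat (x : EuclideanSpace ℝ (Fin 3)) : (imQuat x).imI = x 0 := rfl

theorem imJ_imQuat (x : EuclideanSpace ℝ (Fin 3)) : (imQuat x).imJ = x 1 := rfl

theorem imK_imQuat (x : EuclideanSpace ℝ (Fin 3)) : (imQuat x).imK = x 2 := rfl

theorem factFinrankEuclideanThree :
    Fact (Module.finrank ℝ (EuclideanSpace ℝ (Fin 3)) = 2 + 1) := ⟨by simp⟩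

/-- The unit quaternion `i`. -/
def unitI : SU2 := ⟨imQuat (EuclideanSpace.single 0 1), by simp [norm_imQuat]⟩

/-- The unit quaternion `j`. -/
def unitJ : SU2 := ⟨imQuat (EuclideanSpace.single 1 1), by simp [norm_imQuat]⟩

theorem unitI_mul_self : unitI * unitI = -1 := by
  apply Subtype.ext
  change imQuat (EuclideanSpace.single 0 1) * imQuat (EuclideanSpace.single 0 1) = -1
  ext <;> simp [re_imQuat, imI_imQuat, imJ_imQuat, imK_imQuat]

/-- The sign is written as the group element `-1`, so that the relation can be carried through the
isotropy representation. -/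
theorem unitI_mul_unitJ : unitI * unitJ = (-1) * (unitJ * unitI) := by
  apply Subtype.ext
  change imQuat (EuclideanSpace.single 0 1) * imQuat (EuclideanSpace.single 1 1) =
    (-1) * (imQuat (EuclideanSpace.single 1 1) * imQuat (EuclideanSpace.single 0 1))
  ext <;> simp [re_imQuat, imI_imQuat, imJ_imQuat, imK_imQuat]

theorem coe_smul_S2 (h : SU2) (w : S2) :
    ((h • w : S2) : EuclideanSpace ℝ (Fin 3)) = imPart (h * imQuat w * star (h : ℍ[ℝ])) := rfl

theorem neg_one_smul_S2 (w : S2) : (-1 : SU2) • w = w := by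
  apply Subtype.ext
  rw [coe_smul_S2]
  change imPart ((-1) * imQuat w * star (-1)) = _
  simp [imPart_imQuat]

theorem unitI_smul_e0 : unitI • e0 = e0 := by
  apply Subtype.ext
  rw [coe_smul_S2]
  change imPart (imQuat (EuclideanSpace.single 0 1) * imQuat (EuclideanSpace.single 0 1) *
    star (imQuat (EuclideanSpace.single 0 1))) = EuclideanSpace.single 0 1
  ext i; fin_cases i <;> simp [imPart, re_imQuat, imI_imQuat, imJ_imQuat, imK_imQuat]

theorem unitJ_smul_e0 : unitJ • e0 = -e0 := by
  apply Subtype.ext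
  rw [coe_smul_S2]
  change imPart (imQuat (EuclideanSpace.single 1 1) * imQuat (EuclideanSpace.single 0 1) *
    star (imQuat (EuclideanSpace.single 1 1))) = -EuclideanSpace.single 0 1
  ext i; fin_cases i <;> simp [imPart, re_imQuat, imI_imQuat, imJ_imQuat, imK_imQuat]

/-! ### The differential of the half-turn `i` at `e₀` -/

/-- The rotation of `ℝ³` defined by a unit quaternion. -/
def conjRotation (h : SU2) : EuclideanSpace ℝ (Fin 3) →L[ℝ] EuclideanSpace ℝ (Fin 3) :=
  LinearMap.toContinuousLinearMap
    { toFun := fun x => imPart (h * imQuat x * star (h : ℍ[ℝ]))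
      map_add' := fun x y => by
        have : imQuat (x + y) = imQuat x + imQuat y := by
          ext <;> simp [re_imQuat, imI_imQuat, imJ_imQuat, imK_imQuat]
        rw [this, mul_add, add_mul]
        ext i; fin_cases i <;> simp [imPart]
      map_smul' := fun c x => by
        have : imQuat (c • x) = c • imQuat x := by
          ext <;> simp [re_imQuat, imI_imQuat, imJ_imQuat, imK_imQuat]
        rw [this, mul_smul_comm, smul_mul_assoc]
        ext i; fin_cases i <;> simp [imPart] }

theorem conjRotation_unitI_single_one :
    conjRotation unitI (EuclideanSpace.single 1 1) = -EuclideanSpace.single 1 1 := by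
  change imPart (imQuat (EuclideanSpace.single 0 1) * imQuat (EuclideanSpace.single 1 1) *
    star (imQuat (EuclideanSpace.single 0 1))) = -EuclideanSpace.single 1 1
  ext i; fin_cases i <;> simp [imPart, re_imQuat, imI_imQuat, imJ_imQuat, imK_imQuat]

theorem contMDiff_smul_S2 (h : SU2) : ContMDiff (𝓡 2) (𝓡 2) ∞ (fun w : S2 => h • w) := by
  have := factFinrankEuclideanThree
  have hs : ContMDiff (𝓡 2) 𝓘(ℝ, EuclideanSpace ℝ (Fin 3)) ∞
      (fun w : S2 => conjRotation h (w : EuclideanSpace ℝ (Fin 3))) :=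
    (conjRotation h).contMDiff.comp contMDiff_coe_sphere
  exact hs.codRestrict_sphere fun w => (h • w).2

/-- The differential at `e₀` of the rotation by `i` is not the identity. -/
theorem exists_mfderiv_unitI_ne :
    ∃ w : TangentSpace (𝓡 2) e0,
      tangentMap (𝓡 2) (𝓡 2) (fun z : S2 => unitI • z) ⟨e0, w⟩ ≠ ⟨e0, w⟩ := by
  -- The witness is the second coordinate vector: it is tangent to the sphere at `e₀`, and the
  -- half-turn about `e₀` reverses it.
  have hmem : (EuclideanSpace.single 1 1 : EuclideanSpace ℝ (Fin 3)) ∈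
      (ℝ ∙ (e0 : EuclideanSpace ℝ (Fin 3)))ᗮ := by
    rw [Submodule.mem_orthogonal_singleton_iff_inner_right]
    simp [e0, EuclideanSpace.inner_single_left]
  have := factFinrankEuclideanThree
  rw [← range_mvfderiv_subtypeVal (n := 2) e0] at hmem
  obtain ⟨w, hw⟩ := hmem
  refine ⟨w, fun h => ?_⟩
  have hι : MDifferentiable (𝓡 2) 𝓘(ℝ, EuclideanSpace ℝ (Fin 3))
      (fun z : S2 => (z : EuclideanSpace ℝ (Fin 3))) :=
    (contMDiff_coe_sphere (m := 1)).mdifferentiable (by simp)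
  -- The action and the linear rotation are intertwined by the inclusion of the sphere in `ℝ³`; the
  -- chain rule on both sides reduces the claim to the linear rotation.
  have h1 := tangentMap_comp_at (I := 𝓡 2) (I' := 𝓡 2) (I'' := 𝓘(ℝ, EuclideanSpace ℝ (Fin 3)))
    ⟨e0, w⟩ (hι _) ((contMDiff_smul_S2 unitI).mdifferentiable (by simp) e0)
  have h2 := tangentMap_comp_at (I := 𝓡 2) (I' := 𝓘(ℝ, EuclideanSpace ℝ (Fin 3)))
    (I'' := 𝓘(ℝ, EuclideanSpace ℝ (Fin 3)))
    ⟨e0, w⟩ ((conjRotation unitI).mdifferentiable _) (hι e0)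
  rw [h] at h1
  have h3 : (fun z : S2 => (z : EuclideanSpace ℝ (Fin 3))) ∘ (fun z : S2 => unitI • z) =
    conjRotation unitI ∘ (fun z : S2 => (z : EuclideanSpace ℝ (Fin 3))) := rfl
  rw [h3] at h1
  have h4 := h2.symm.trans h1
  have h5 : conjRotation unitI (EuclideanSpace.single 1 1) =
      (EuclideanSpace.single 1 1 : EuclideanSpace ℝ (Fin 3)) := by
    have h6 := congrArg (fun z : TangentBundle 𝓘(ℝ, EuclideanSpace ℝ (Fin 3))
      (EuclideanSpace ℝ (Fin 3)) => (z.2 : EuclideanSpace ℝ (Fin 3))) h4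
    simp only [tangentMap, ContinuousLinearMap.mfderiv_eq] at h6
    rw [← hw]
    exact h6
  rw [conjRotation_unitI_single_one] at h5
  have := congrArg (fun v : EuclideanSpace ℝ (Fin 3) => v 1) h5
  norm_num at this

/-! ### Centralisers in the quaternions and the kernel of `Spin(4) → SO(4)` -/

/-- The centraliser of a non-real `u` is the commutative plane `ℝ + ℝu`: commuting with `u` means
that the imaginary part is parallel to that of `u`. -/
theorem mul_comm_of_commute_of_im_ne_zero {a b u : ℍ[ℝ]} (hu : u.im ≠ 0)
    (ha : a * u = u * a) (hb : b * u = u * b) : a * b = b * a := by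
  have ha1 := congrArg QuaternionAlgebra.imI ha
  have ha2 := congrArg QuaternionAlgebra.imJ ha
  have ha3 := congrArg QuaternionAlgebra.imK ha
  have hb1 := congrArg QuaternionAlgebra.imI hb
  have hb2 := congrArg QuaternionAlgebra.imJ hb
  have hb3 := congrArg QuaternionAlgebra.imK hb
  rw [Quaternion.imI_mul, Quaternion.imI_mul] at ha1 hb1
  rw [Quaternion.imJ_mul, Quaternion.imJ_mul] at ha2 hb2
  rw [Quaternion.imK_mul, Quaternion.imK_mul] at ha3 hb3
  have hu' : u.imI ≠ 0 ∨ u.imJ ≠ 0 ∨ u.imK ≠ 0 := by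
    by_contra! h
    exact hu (by ext <;> simp [h.1, h.2.1, h.2.2])
  -- `h1`, `h2`, `h3` say that the cross product of the imaginary parts of `a` and `b` vanishes;
  -- each is checked after multiplication by a non-zero coordinate of `u`.
  have h1 : a.imJ * b.imK = a.imK * b.imJ := by
    rcases hu' with h | h | h <;> apply mul_left_cancel₀ h <;> grind
  have h2 : a.imK * b.imI = a.imI * b.imK := by
    rcases hu' with h | h | h <;> apply mul_left_cancel₀ h <;> grind
  have h3 : a.imI * b.imJ = a.imJ * b.imI := by
    rcases hu' with h | h | h <;> apply mul_left_cancel₀ h <;> grind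
  ext
  · rw [Quaternion.re_mul, Quaternion.re_mul]; linarith
  · rw [Quaternion.imI_mul, Quaternion.imI_mul]; linarith
  · rw [Quaternion.imJ_mul, Quaternion.imJ_mul]; linarith
  · rw [Quaternion.imK_mul, Quaternion.imK_mul]; linarith

theorem eq_one_or_neg_one_of_im_eq_zero {u : SU2} (h : (u : ℍ[ℝ]).im = 0) :
    u = 1 ∨ u = -1 := by
  have hre : (u : ℍ[ℝ]) = ((u : ℍ[ℝ]).re : ℍ[ℝ]) := by
    conv_lhs => rw [← Quaternion.re_add_im (u : ℍ[ℝ]), h, add_zero]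
  have hn : |(u : ℍ[ℝ]).re| = 1 := by
    rw [← Real.norm_eq_abs, ← Quaternion.norm_coe, ← hre]; simp
  rcases eq_or_eq_neg_of_abs_eq hn with h1 | h1
  · left; apply Subtype.ext; rw [hre, h1]; simp
  · right; apply Subtype.ext; rw [hre, h1]; simp

/-- A unit quaternion which commutes with two anticommuting unit quaternions is `1` or `-1`. -/
theorem eq_one_or_neg_one_of_commute {a b u : SU2} (hab : a * b = (-1) * (b * a))
    (ha : a * u = u * a) (hb : b * u = u * b) : u = 1 ∨ u = -1 := by
  have hab' : (a : ℍ[ℝ]) * b = (-1) * (b * a) := congrArg Subtype.val hab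
  have hne : (a : ℍ[ℝ]) * b ≠ 0 := by
    rw [← norm_ne_zero_iff, norm_mul]; simp
  have him : (u : ℍ[ℝ]).im = 0 := by
    -- If `u` were not real, `a` and `b` would commute as well as anticommute, which forces `2ba =
    -- 0`.
    by_contra h
    have := mul_comm_of_commute_of_im_ne_zero h (congrArg Subtype.val ha)
      (congrArg Subtype.val hb)
    rw [this] at hab' hne
    have h2 : (2 : ℝ) • ((b : ℍ[ℝ]) * a) = 0 := by
      rw [two_smul]; nth_rw 1 [hab']; simp
    exact hne ((smul_eq_zero.1 h2).resolve_left two_ne_zero)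
  exact eq_one_or_neg_one_of_im_eq_zero him

theorem eq_one_or_neg_one_of_mul_self {a : SU2} (h : a * a = 1) : a = 1 ∨ a = -1 := by
  have h1 : (a : ℍ[ℝ]) * a = 1 := congrArg Subtype.val h
  rcases mul_self_eq_one_iff.1 h1 with h | h
  · exact .inl (Subtype.ext h)
  · exact .inr (Subtype.ext h)

/-- An element of `Spin(4)` that acts trivially on `ℍ` is `1` or `-1`. -/
theorem eq_one_or_neg_one_of_spin_action {a b : SU2}
    (h : ∀ u : ℍ[ℝ], (a : ℍ[ℝ]) * u * (b : ℍ[ℝ])⁻¹ = u) :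
    (a = 1 ∧ b = 1) ∨ (a = -1 ∧ b = -1) := by
  have hb : (b : ℍ[ℝ]) ≠ 0 := by rw [← norm_ne_zero_iff]; simp
  have h' : ∀ u : ℍ[ℝ], (a : ℍ[ℝ]) * u = u * b := fun u => by
    conv_rhs => rw [← h u]
    rw [mul_assoc _ _ (b : ℍ[ℝ]), inv_mul_cancel₀ hb, mul_one]
  -- The value at `u = 1` gives `a = b`; then `a` is central and in particular commutes with `i` and
  -- `j`.
  obtain rfl : a = b := Subtype.ext (by simpa using h' 1)
  have hc : ∀ u : SU2, u * a = a * u := fun u => Subtype.ext (h' u).symm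
  rcases eq_one_or_neg_one_of_commute unitI_mul_unitJ (hc _) (hc _) with h | h <;> simp [h]

/-! ### Fibres of principal bundles -/

namespace IsPrincipalBundle

variable {EG HG EP HP EM HM : Type*}
    [NormedAddCommGroup EG] [NormedSpace ℝ EG] [TopologicalSpace HG]
    [NormedAddCommGroup EP] [NormedSpace ℝ EP] [TopologicalSpace HP]
    [NormedAddCommGroup EM] [NormedSpace ℝ EM] [TopologicalSpace HM]
    {IG : ModelWithCorners ℝ EG HG} {IP : ModelWithCorners ℝ EP HP}
    {IM : ModelWithCorners ℝ EM HM}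
    {G : Type*} [TopologicalSpace G] [ChartedSpace HG G] [Group G]
    {P M : Type*} [TopologicalSpace P] [ChartedSpace HP P] [TopologicalSpace M]
    [ChartedSpace HM M] [MulAction Gᵐᵒᵖ P] {π : P → M}

theorem surjective (hπ : IsPrincipalBundle IG IP IM G π) : Surjective π := by
  intro x
  obtain ⟨e, hx, -⟩ := hπ.locally_trivial x
  exact ⟨e.toOpenPartialHomeomorph.symm (x, 1), e.proj_symm_apply' hx⟩

/-- The structure group acts transitively on the fibres. -/
theorem exists_smul_eq (hπ : IsPrincipalBundle IG IP IM G π) {x y : P} (h : π x = π y) :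
    ∃ g : G, y = MulOpposite.op g • x := by
  obtain ⟨e, hx, -, -, he⟩ := hπ.locally_trivial (π x)
  have hxs : x ∈ e.source := e.mem_source.2 hx
  have hys : y ∈ e.source := e.mem_source.2 (h ▸ hx)
  refine ⟨(e x).2⁻¹ * (e y).2, ?_⟩
  have hgs : MulOpposite.op ((e x).2⁻¹ * (e y).2) • x ∈ e.source :=
    e.mem_source.2 (by rwa [hπ.proj_act])
  apply e.injOn hys hgs
  change e y = e _
  rw [he _ hxs, mul_inv_cancel_left]
  refine Prod.ext ?_ rfl
  rw [e.coe_fst hys, e.coe_fst hxs, h]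

/-- The structure group acts freely. -/
theorem smul_injective (hπ : IsPrincipalBundle IG IP IM G π) {x : P} {g h : G}
    (H : MulOpposite.op g • x = MulOpposite.op h • x) : g = h := by
  obtain ⟨e, hx, -, -, he⟩ := hπ.locally_trivial (π x)
  have hxs : x ∈ e.source := e.mem_source.2 hx
  have h1 := congrArg (fun z => (e z).2) H
  simp only [he _ hxs] at h1
  exact mul_left_cancel h1

end IsPrincipalBundle

/-! ### Stabilisers and differentials on the twisted product -/

section TwistedProduct

variable {F M : Type*} [TopologicalSpace F]
    [ChartedSpace (EuclideanSpace ℝ (Fin 2)) F] [TopologicalSpace M]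
    [ChartedSpace (EuclideanSpace ℝ (Fin 4)) M] [MulAction SU2 M]
    {σ₁ : F → F} {q : F × S2 → M}

/-- The action of `SU(2)` on `F × S(v)`. -/
def prodRotation (F : Type*) (h : SU2) (x : F × S2) : F × S2 := (x.1, h • x.2)

theorem contMDiff_prodRotation (h : SU2) :
    ContMDiff ((𝓡 2).prod (𝓡 2)) ((𝓡 2).prod (𝓡 2)) ∞ (prodRotation F h) :=
  contMDiff_fst.prodMk ((contMDiff_smul_S2 h).comp contMDiff_snd)

namespace IsTwistedProduct

theorem neg_one_smul (hq : IsTwistedProduct σ₁ q) (x : M) : (-1 : SU2) • x = x := by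
  obtain ⟨⟨f, w⟩, rfl⟩ := hq.surjective x
  rw [← hq.smul, neg_one_smul_S2]

theorem unitI_smul (hq : IsTwistedProduct σ₁ q) (f : F) :
    unitI • q (f, e0) = q (f, e0) := by
  rw [← hq.smul, unitI_smul_e0]

/-- This is where the choice of a base point over the fixed circle enters: there `(f, -e₀)` and `(f,
e₀)` are identified, so the stabiliser is not commutative. -/
theorem unitJ_smul (hq : IsTwistedProduct σ₁ q) {f : F} (hf : σ₁ f = f) :
    unitJ • q (f, e0) = q (f, e0) := by
  rw [← hq.smul, unitJ_smul_e0, hq.eq_iff]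
  exact .inr (by simp [hf])

/-- Locally the action on `M` is the rotation of `F × S(v)` conjugated by the local diffeomorphism
`q`. -/
theorem mdifferentiable_smul (hq : IsTwistedProduct σ₁ q) (h : SU2) :
    MDifferentiable (𝓡 4) (𝓡 4) (fun y : M => h • y) := by
  intro y
  obtain ⟨x, rfl⟩ := hq.surjective y
  have hx := hq.localDiffeo x
  have h1 : MDifferentiableAt (𝓡 4) (𝓡 4) (q ∘ prodRotation F h ∘ hx.localInverse) (q x) :=
    (hq.localDiffeo.mdifferentiable (by simp) _).comp _
      (((contMDiff_prodRotation h).mdifferentiable (by simp) _).comp _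
        (hx.localInverse_mdifferentiableAt (by simp)))
  refine h1.congr_of_eventuallyEq ?_
  filter_upwards [hx.localInverse_eventuallyEq_right] with y hy
  change h • y = q (_, h • _)
  rw [hq.smul]
  exact congrArg (fun z : M => h • z) hy.symm

/-- If the differential of the action of `i` at `[f, e₀]` is multiplication by a scalar, then so
is the differential of the action on `F × S(v)`. -/
theorem tangentMap_prodRotation_unitI (hq : IsTwistedProduct σ₁ q) (f : F) (s : ℝ)
    (hs : ∀ V : TangentSpace (𝓡 4) (q (f, e0)),
      tangentMap (𝓡 4) (𝓡 4) (fun y : M => unitI • y) ⟨q (f, e0), V⟩ = ⟨q (f, e0), s • V⟩)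
    (W : TangentSpace ((𝓡 2).prod (𝓡 2)) (f, e0)) :
    tangentMap ((𝓡 2).prod (𝓡 2)) ((𝓡 2).prod (𝓡 2)) (prodRotation F unitI) ⟨(f, e0), W⟩ =
      ⟨(f, e0), s • W⟩ := by
  have hqd : MDifferentiable ((𝓡 2).prod (𝓡 2)) (𝓡 4) q :=
    hq.localDiffeo.mdifferentiable (by simp)
  have h1 := tangentMap_comp_at (I := (𝓡 2).prod (𝓡 2)) (I' := (𝓡 2).prod (𝓡 2)) (I'' := 𝓡 4)
    ⟨(f, e0), W⟩ (hqd _) ((contMDiff_prodRotation unitI).mdifferentiable (by simp) (f, e0))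
  have h2 := tangentMap_comp_at (I := (𝓡 2).prod (𝓡 2)) (I' := 𝓡 4) (I'' := 𝓡 4)
    ⟨(f, e0), W⟩ (hq.mdifferentiable_smul unitI _) (hqd (f, e0))
  have h3 : q ∘ prodRotation F unitI = (fun y : M => unitI • y) ∘ q :=
    funext fun x => hq.smul unitI x.1 x.2
  have h4 : tangentMap ((𝓡 2).prod (𝓡 2)) (𝓡 4) q ⟨(f, e0), s • W⟩ =
      ⟨q (f, e0), s • mfderiv ((𝓡 2).prod (𝓡 2)) (𝓡 4) q (f, e0) W⟩ := by
    simp only [tangentMap, map_smul]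
  rw [h3] at h1
  have h5 := h1.symm.trans (h2.trans ((hs _).trans h4.symm))
  -- Stated for points of the tangent bundle, so that vectors based at `unitI • e0` and at `e0` can
  -- be compared without transport.
  have inj : ∀ X Y : TangentBundle ((𝓡 2).prod (𝓡 2)) (F × S2), X.1 = Y.1 →
      tangentMap ((𝓡 2).prod (𝓡 2)) (𝓡 4) q X = tangentMap ((𝓡 2).prod (𝓡 2)) (𝓡 4) q Y →
      X = Y := by
    rintro ⟨x, X⟩ ⟨y, Y⟩ (rfl : x = y) h
    have h' := Bundle.TotalSpace.mk_injective _ h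
    exact congrArg (Bundle.TotalSpace.mk x)
      ((hq.localDiffeo.mfderivToContinuousLinearEquiv (by simp) x).injective h')
  refine inj _ _ ?_ h5
  change (f, unitI • e0) = (f, e0)
  rw [unitI_smul_e0]

/-- The differential of the action of `i` at `[f, e₀]` is not multiplication by a scalar: it is
the identity on the tangent space of `F`, but not on the tangent space of `S(v)`. -/
theorem mfderiv_unitI_ne_smul (hq : IsTwistedProduct σ₁ q) (f : F) (s : ℝ) :
    ¬ ∀ V : TangentSpace (𝓡 4) (q (f, e0)),
      tangentMap (𝓡 4) (𝓡 4) (fun y : M => unitI • y) ⟨q (f, e0), V⟩ =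
        ⟨q (f, e0), s • V⟩ := by
  intro hs
  have hW := hq.tangentMap_prodRotation_unitI f s hs
  have hd := (contMDiff_prodRotation (F := F) unitI).mdifferentiable (by simp)
  -- Vectors tangent to `F` are fixed by the differential, so the scalar must be `1`; the tangent
  -- space of the sphere then gives the contradiction.
  have hfst : ∀ v : EuclideanSpace ℝ (Fin 2), v = s • v := by
    intro v
    have h1 := tangentMap_comp_at (I := (𝓡 2).prod (𝓡 2)) (I' := (𝓡 2).prod (𝓡 2))
      (I'' := 𝓡 2) ⟨(f, e0), (v, 0)⟩ (mdifferentiableAt_fst (M' := S2)) (hd (f, e0))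
    replace h1 := h1.trans (congrArg (tangentMap ((𝓡 2).prod (𝓡 2)) (𝓡 2) Prod.fst) (hW (v, 0)))
    rw [tangentMap_prodFst] at h1
    have h2 : (Prod.fst : F × S2 → F) ∘ prodRotation F unitI = Prod.fst := rfl
    rw [h2, tangentMap_prodFst] at h1
    exact congrArg (fun z : TangentBundle (𝓡 2) F => (z.2 : EuclideanSpace ℝ (Fin 2))) h1
  obtain rfl : s = 1 := by
    have := congrArg (fun v : EuclideanSpace ℝ (Fin 2) => v 0) (hfst (EuclideanSpace.single 0 1))
    simpa using this.symm
  simp only [one_smul] at hW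
  obtain ⟨w, hw⟩ := exists_mfderiv_unitI_ne
  apply hw
  have h1 := tangentMap_comp_at (I := (𝓡 2).prod (𝓡 2)) (I' := (𝓡 2).prod (𝓡 2))
    (I'' := 𝓡 2) ⟨(f, e0), (0, w)⟩ (mdifferentiableAt_snd (M := F)) (hd (f, e0))
  have h2 := tangentMap_comp_at (I := (𝓡 2).prod (𝓡 2)) (I' := 𝓡 2)
    (I'' := 𝓡 2) ⟨(f, e0), (0, w)⟩ ((contMDiff_smul_S2 unitI).mdifferentiable (by simp) _)
    (mdifferentiableAt_snd (M := F))
  have h3 : (Prod.snd : F × S2 → S2) ∘ prodRotation F unitI =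
    (fun z : S2 => unitI • z) ∘ Prod.snd := rfl
  replace h1 := h1.trans (congrArg (tangentMap ((𝓡 2).prod (𝓡 2)) (𝓡 2) Prod.snd) (hW (0, w)))
  rw [h3, tangentMap_prodSnd] at h1
  rw [tangentMap_prodSnd] at h2
  exact h2.symm.trans h1

end IsTwistedProduct

end TwistedProduct

/-! ### Isotropy representations and the spin structure -/

theorem op_smul_op_smul_SU2 {P : Type*} [MulAction SU2ᵐᵒᵖ P] (g h : SU2) (p : P) :
    MulOpposite.op g • MulOpposite.op h • p = MulOpposite.op (h * g) • p :=
  (mul_smul (MulOpposite.op g) (MulOpposite.op h) p).symm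

theorem op_one_smul_SU2 {P : Type*} [MulAction SU2ᵐᵒᵖ P] (p : P) :
    MulOpposite.op (1 : SU2) • p = p :=
  one_smul SU2ᵐᵒᵖ p

/-- Because the left and right actions commute, the element of `G` by which a stabiliser element
moves `x` depends multiplicatively on it, in the same order. -/
theorem IsEquivariantPrincipalBundle.mul_smul_eq {EG HG EP HP EM HM EK HK : Type*}
    [NormedAddCommGroup EG] [NormedSpace ℝ EG] [TopologicalSpace HG]
    [NormedAddCommGroup EP] [NormedSpace ℝ EP] [TopologicalSpace HP]
    [NormedAddCommGroup EM] [NormedSpace ℝ EM] [TopologicalSpace HM]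
    [NormedAddCommGroup EK] [NormedSpace ℝ EK] [TopologicalSpace HK]
    {IG : ModelWithCorners ℝ EG HG} {IP : ModelWithCorners ℝ EP HP}
    {IM : ModelWithCorners ℝ EM HM} {IK : ModelWithCorners ℝ EK HK}
    {G : Type*} [TopologicalSpace G] [ChartedSpace HG G] [Group G]
    {H : Type*} [TopologicalSpace H] [ChartedSpace HK H] [Group H]
    {P M : Type*} [TopologicalSpace P] [ChartedSpace HP P] [TopologicalSpace M]
    [ChartedSpace HM M] [MulAction Gᵐᵒᵖ P] [MulAction H P] [MulAction H M] {π : P → M}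
    (hπ : IsEquivariantPrincipalBundle IG IP IM IK G H π) {x : P} {h k : H} {s t : G}
    (hs : h • x = MulOpposite.op s • x) (ht : k • x = MulOpposite.op t • x) :
    (h * k) • x = MulOpposite.op (s * t) • x := by
  rw [mul_smul, ht, hπ.comm, hs, MulOpposite.op_mul, mul_smul]

namespace IsSpinStructure

variable {Q M : Type*} [TopologicalSpace Q]
    [ChartedSpace (EuclideanSpace ℝ (Fin 10)) Q] [TopologicalSpace M]
    [ChartedSpace (EuclideanSpace ℝ (Fin 4)) M] [IsManifold (𝓡 4) ∞ M]
    [MulAction Spin4ᵐᵒᵖ Q] [MulAction SU2 Q] [MulAction SU2 M] {γ : Metric4 M} {π : Q → M}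
    {e : ∀ y : Q, ℍ[ℝ] →L[ℝ] TangentSpace (𝓡 4) (π y)}

theorem frame_injective (hQ : IsSpinStructure γ π e) (y : Q) : Injective (e y) := by
  refine (injective_iff_map_eq_zero (e y)).2 fun u hu => ?_
  have h := hQ.isometry y u u
  rw [hu] at h
  exact inner_self_eq_zero.1 (h.symm.trans (by simp))

theorem frame_surjective (hQ : IsSpinStructure γ π e) (y : Q) : Surjective (e y) := by
  have hd : Module.finrank ℝ ℍ[ℝ] = Module.finrank ℝ (EuclideanSpace ℝ (Fin 4)) := by
    rw [Quaternion.finrank_eq_four, finrank_euclideanSpace_fin]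
  have : FiniteDimensional ℝ (TangentSpace (𝓡 4) (π y)) :=
    inferInstanceAs (FiniteDimensional ℝ (EuclideanSpace ℝ (Fin 4)))
  exact (LinearMap.injective_iff_surjective_of_finrank_eq_finrank
    (f := (e y : ℍ[ℝ] →ₗ[ℝ] TangentSpace (𝓡 4) (π y))) hd).1 (hQ.frame_injective y)

/-- If `h` acts on a point of the spin structure as `(a, b)`, then its differential is
`x ↦ a x b⁻¹` in the corresponding frame. -/
theorem tangentMap_frame (hQ : IsSpinStructure γ π e) {y : Q} {h : SU2} {s : Spin4}
    (hs : h • y = MulOpposite.op s • y) (u : ℍ[ℝ]) :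
    tangentMap (𝓡 4) (𝓡 4) (fun x : M => h • x) ⟨π y, e y u⟩ =
      ⟨π y, e y ((s.1 : ℍ[ℝ]) * u * (s.2 : ℍ[ℝ])⁻¹)⟩ := by
  rw [← hQ.lift, ← hQ.equivariant]
  exact congrArg (fun z : Q => (⟨π z, e z u⟩ : TangentBundle (𝓡 4) M)) hs

theorem exists_smul_eq (hQ : IsSpinStructure γ π e) {y : Q} {h : SU2} (hh : h • π y = π y) :
    ∃ s : Spin4, h • y = MulOpposite.op s • y :=
  hQ.bundle.exists_smul_eq (by rw [hQ.bundle.proj_left, hh])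

/-- The isotropy representation of the spin structure at a point over `[f, e₀]`: the unit
quaternions `i` and `j` act as elements of `Spin(4)` whose components anticommute. -/
theorem exists_anticommuting (hQ : IsSpinStructure γ π e)
    {F : Type*} [TopologicalSpace F] [ChartedSpace (EuclideanSpace ℝ (Fin 2)) F]
    {σ₁ : F → F} {q : F × S2 → M} (hq : IsTwistedProduct σ₁ q) {f : F} (hf : σ₁ f = f)
    {y : Q} (hy : π y = q (f, e0)) :
    ∃ s t : Spin4, unitI • y = MulOpposite.op s • y ∧ unitJ • y = MulOpposite.op t • y ∧
      s * t = (-1, -1) * (t * s) := by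
  obtain ⟨s, hs⟩ := hQ.exists_smul_eq (y := y) (h := unitI) (by rw [hy, hq.unitI_smul])
  obtain ⟨t, ht⟩ := hQ.exists_smul_eq (y := y) (h := unitJ) (by rw [hy, hq.unitJ_smul hf])
  refine ⟨s, t, hs, ht, ?_⟩
  -- `-1 = i²` acts on `y` as `s²`, and it acts trivially on `M`, so `s²` fixes every frame vector.
  have hss := hQ.bundle.mul_smul_eq hs hs
  rw [unitI_mul_self] at hss
  have htriv : ∀ u : ℍ[ℝ], ((s * s).1 : ℍ[ℝ]) * u * ((s * s).2 : ℍ[ℝ])⁻¹ = u := by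
    intro u
    have h1 := hQ.tangentMap_frame hss u
    have h2 : (fun x : M => (-1 : SU2) • x) = id := funext hq.neg_one_smul
    rw [h2, tangentMap_id] at h1
    exact (hQ.frame_injective y (Bundle.TotalSpace.mk_injective _ h1)).symm
  have hneg : s * s = (-1, -1) := by
    rcases eq_one_or_neg_one_of_spin_action htriv with ⟨h1, h2⟩ | ⟨h1, h2⟩
    swap
    · exact Prod.ext h1 h2
    exfalso
    -- In the case `s² = (1, 1)` both components of `s` are `±1`, and the isometry `x ↦ a x b⁻¹` is
    -- `±1`.
    have hscal : ∃ c : ℝ, ∀ u : ℍ[ℝ], (s.1 : ℍ[ℝ]) * u * (s.2 : ℍ[ℝ])⁻¹ = c • u := by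
      rcases eq_one_or_neg_one_of_mul_self h1 with h1 | h1 <;>
      rcases eq_one_or_neg_one_of_mul_self h2 with h2 | h2 <;> rw [h1, h2]
      exacts [⟨1, by simp⟩, ⟨-1, by simp⟩, ⟨-1, by simp⟩, ⟨1, by simp⟩]
    obtain ⟨c, hc⟩ := hscal
    have hV : ∀ V : TangentSpace (𝓡 4) (π y),
        tangentMap (𝓡 4) (𝓡 4) (fun x : M => unitI • x) ⟨π y, V⟩ = ⟨π y, c • V⟩ := by
      intro V
      obtain ⟨u, rfl⟩ := hQ.frame_surjective y V
      rw [hQ.tangentMap_frame hs, hc, map_smul]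
    rw [hy] at hV
    exact hq.mfderiv_unitI_ne_smul f c hV
  -- With `(-1, -1)` rewritten as `s²`, the claim compares the actions of `ij` and of `(-1)ji` on
  -- `y`; the structure group acts freely.
  rw [← hneg]
  refine hQ.bundle.smul_injective (x := y) ?_
  rw [← hQ.bundle.mul_smul_eq hs ht, unitI_mul_unitJ]
  exact hQ.bundle.mul_smul_eq hss (hQ.bundle.mul_smul_eq ht hs)

end IsSpinStructure

/-! ### The invariant gauge group and its based subgroup -/

section Gauge

variable {P M : Type*} [TopologicalSpace P] [ChartedSpace (EuclideanSpace ℝ (Fin 7)) P]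
  [TopologicalSpace M] [ChartedSpace (EuclideanSpace ℝ (Fin 4)) M]
  [MulAction SU2ᵐᵒᵖ P] [MulAction SU2 P] [MulAction SU2 M]

theorem neg_one_mul_comm_SU2 (g : SU2) : (-1) * g = g * (-1) := by
  apply Subtype.ext
  change (-1) * (g : ℍ[ℝ]) = g * (-1)
  simp

theorem neg_one_mul_neg_one_SU2 : (-1 : SU2) * (-1) = 1 := by
  apply Subtype.ext
  change (-1) * (-1 : ℍ[ℝ]) = 1
  simp

theorem neg_one_ne_one_SU2 : (-1 : SU2) ≠ 1 := fun h => by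
  have h1 : (-1 : ℍ[ℝ]) = 1 := congrArg Subtype.val h
  have := congrArg QuaternionAlgebra.re h1
  norm_num at this

theorem op_neg_one_inv_SU2 : (MulOpposite.op (-1 : SU2))⁻¹ = MulOpposite.op (-1) := by
  rw [← MulOpposite.op_inv, inv_eq_of_mul_eq_one_left neg_one_mul_neg_one_SU2]

/-- The invariant gauge transformation given by the element `-1` of the centre of the structure
group. -/
def negGauge (π : P → M) [hπ : IsEquivariantSU2Bundle π] : invariantGaugeGroup π :=
  ⟨MulAction.toPerm (MulOpposite.op (-1 : SU2)), InvariantConnection.mdiff_right π (-1), by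
      change ContMDiff _ _ _ fun p : P => (MulOpposite.op (-1 : SU2))⁻¹ • p
      rw [op_neg_one_inv_SU2]
      exact InvariantConnection.mdiff_right π (-1),
    fun p => hπ.out.proj_act p (-1), fun g p => by
      change MulOpposite.op (-1 : SU2) • MulOpposite.op g • p =
        MulOpposite.op g • MulOpposite.op (-1 : SU2) • p
      rw [op_smul_op_smul_SU2, op_smul_op_smul_SU2, neg_one_mul_comm_SU2],
    fun h p => (hπ.out.comm h (-1) p).symm⟩

/-- A gauge transformation which moves a point of the fibre over `m` by a central element of the
structure group moves the whole fibre by this element. -/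
theorem gauge_apply_of_central (π : P → M) [hπ : IsEquivariantSU2Bundle π]
    (φ : invariantGaugeGroup π) {u : SU2} (hu : ∀ g : SU2, u * g = g * u) {p₀ : P}
    (h₀ : (φ : Equiv.Perm P) p₀ = MulOpposite.op u • p₀) {p : P} (hp : π p = π p₀) :
    (φ : Equiv.Perm P) p = MulOpposite.op u • p := by
  obtain ⟨g, rfl⟩ := hπ.out.exists_smul_eq hp.symm
  rw [φ.2.2.2.2.1, h₀, op_smul_op_smul_SU2, op_smul_op_smul_SU2, hu]

/-- If every invariant gauge transformation acts on a point `p₀` of the fibre over `m` as `1` or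
`-1`, then the based invariant gauge group has index two. -/
theorem xor_mem_basedGaugeGroup (π : P → M) [hπ : IsEquivariantSU2Bundle π] {m : M} {p₀ : P}
    (hp₀ : π p₀ = m)
    (H : ∀ (φ : invariantGaugeGroup π) (u : SU2),
      (φ : Equiv.Perm P) p₀ = MulOpposite.op u • p₀ → u = 1 ∨ u = -1)
    (φ : invariantGaugeGroup π) :
    Xor (φ * negGauge π ∈ basedGaugeGroup π m) (φ ∈ basedGaugeGroup π m) := by
  subst hp₀
  obtain ⟨u, hu⟩ := hπ.out.exists_smul_eq (φ.2.2.2.1 p₀).symm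
  have hmul : ∀ p, ((φ * negGauge π : invariantGaugeGroup π) : Equiv.Perm P) p =
      MulOpposite.op (-1 : SU2) • (φ : Equiv.Perm P) p := fun p => φ.2.2.2.2.1 (-1) p
  have hfix : ∀ {g : SU2}, MulOpposite.op g • p₀ = p₀ → g = 1 := fun h =>
    hπ.out.smul_injective (by rw [h, op_one_smul_SU2])
  rcases H φ u hu with rfl | rfl
  · refine .inr ⟨fun p hp => ?_, fun h => ?_⟩
    · rw [gauge_apply_of_central π φ (by simp) hu hp, op_one_smul_SU2]
    · have h1 := h p₀ rfl
      rw [hmul, hu, op_one_smul_SU2] at h1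
      exact neg_one_ne_one_SU2 (hfix h1)
  · refine .inl ⟨fun p hp => ?_, fun h => ?_⟩
    · rw [hmul, gauge_apply_of_central π φ neg_one_mul_comm_SU2 hu hp,
        op_smul_op_smul_SU2, neg_one_mul_neg_one_SU2, op_one_smul_SU2]
    · exact neg_one_ne_one_SU2 (hfix (hu.symm.trans (h p₀ rfl)))

theorem nonempty_quotient_mulEquiv_of_xor {G : Type*} [Group G] (N : Subgroup G) [N.Normal]
    (a : G) (h : ∀ b, Xor (b * a ∈ N) (b ∈ N)) :
    Nonempty ((G ⧸ N) ≃* Multiplicative (ZMod 2)) := by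
  have : Fact (Nat.Prime 2) := ⟨Nat.prime_two⟩
  exact ⟨mulEquivOfPrimeCardEq (p := 2) (Subgroup.index_eq_two_iff.2 ⟨a, h⟩) (by simp)⟩

/-! ### Connections and orbit spaces -/

variable [IsManifold (𝓡 7) ∞ P]

/-- Translation by `-1` changes a connection form by the adjoint action of `-1`, which is trivial
since `-1` is central. -/
theorem op_negGauge_smul (π : P → M) [IsEquivariantSU2Bundle π] (A : InvariantConnection P) :
    MulOpposite.op (negGauge π) • A = A := by
  ext p : 2
  refine ContinuousLinearMap.ext fun v => ?_
  refine (A.adjoint (-1) p v).trans ?_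
  change (-1 : ℍ[ℝ])⁻¹ * A.form p v * (-1) = A.form p v
  simp [inv_neg]

/-- Either `φ` or its product with `-1` is based, and both have the same effect on connections, so
the two groups have the same orbits. -/
theorem orbitProj_bijective (π : P → M) [IsEquivariantSU2Bundle π] (m : M)
    (H : ∀ φ : invariantGaugeGroup π,
      Xor (φ * negGauge π ∈ basedGaugeGroup π m) (φ ∈ basedGaugeGroup π m)) :
    Bijective (orbitProj π m) := by
  refine ⟨fun a b => ?_, fun b => ?_⟩
  · induction a using Quotient.inductionOn' with | _ A
    induction b using Quotient.inductionOn' with | _ B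
    intro h
    obtain ⟨φ, hφ⟩ := Quotient.exact' h
    apply Quotient.sound'
    rcases H φ.unop with h1 | h1
    · refine ⟨⟨MulOpposite.op (φ.unop * negGauge π), h1.1⟩, ?_⟩
      change MulOpposite.op (φ.unop * negGauge π) • B = A
      rw [MulOpposite.op_mul, mul_smul]
      exact (congrArg _ hφ).trans (op_negGauge_smul π A)
    · exact ⟨⟨φ, h1.1⟩, hφ⟩
  · induction b using Quotient.inductionOn' with | _ B
    exact ⟨Quotient.mk'' B, rfl⟩

/-- Both topologies are coinduced from the same topology on connections, and the projection is
compatible with the quotient maps. -/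
theorem isHomeomorph_orbitProj (π : P → M) [IsEquivariantSU2Bundle π] (m : M) (k : ℕ) (p lam : ℝ)
    (H : Bijective (orbitProj π m)) :
    @IsHomeomorph _ _ (basedOrbitTopology π m k p lam) (orbitTopology π k p lam)
      (orbitProj π m) := by
  let := morreyTopology π k p lam
  let := basedOrbitTopology π m k p lam
  let := orbitTopology π k p lam
  refine ⟨continuous_quot_lift _ continuous_quot_mk, fun U hU => ?_, H⟩
  refine isOpen_coinduced.2 ?_
  convert isOpen_coinduced.1 hU using 1
  ext A
  -- By injectivity, the image of `U` and `U` itself have the same preimage in the space of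
  -- connections.
  exact H.1.mem_set_image (a := Quotient.mk'' A)

end Gauge

end

theorem proposition3p3p6 (g : ℕ)
    -- the closed oriented surface `F` of genus `2 g`, its reflection and a fixed point `f₀`
    {F : Type*} [TopologicalSpace F] [T2Space F] [CompactSpace F] [ConnectedSpace F]
    [ChartedSpace (EuclideanSpace ℝ (Fin 2)) F] [IsManifold (𝓡 2) ∞ F]
    (hF : HasGenus F (2 * g)) (σ₁ : F → F) (hσ : IsReflection σ₁)
    (f₀ : F) (hf₀ : σ₁ f₀ = f₀)
    -- the manifold `M` with its action of `SU(2)` and an invariant metric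
    {M : Type*} [TopologicalSpace M] [T2Space M]
    [ChartedSpace (EuclideanSpace ℝ (Fin 4)) M] [IsManifold (𝓡 4) ∞ M] [MulAction SU2 M]
    (q : F × S2 → M) (hq : IsTwistedProduct σ₁ q)
    (γ : Metric4 M) (hγ : IsInvariantMetric γ)
    -- a spin structure of `M` with the lift of the action
    {Q : Type*} [TopologicalSpace Q] [ChartedSpace (EuclideanSpace ℝ (Fin 10)) Q]
    [IsManifold (𝓡 10) ∞ Q] [MulAction Spin4ᵐᵒᵖ Q] [MulAction SU2 Q]
    (πQ : Q → M) (e : ∀ y : Q, ℍ[ℝ] →L[ℝ] TangentSpace (𝓡 4) (πQ y))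
    (hQ : IsSpinStructure γ πQ e)
    -- the spinor bundle of chirality `c`
    (c : Chirality)
    {P : Type*} [TopologicalSpace P] [ChartedSpace (EuclideanSpace ℝ (Fin 7)) P]
    [IsManifold (𝓡 7) ∞ P] [MulAction SU2ᵐᵒᵖ P] [MulAction SU2 P]
    (π : P → M) [IsEquivariantSU2Bundle π] (r : Q → P) (hP : IsSpinorBundle c πQ π r)
    -- the space `L^{k,p}_λ` whose norm induces the topology on connections
    (k : ℕ) (p lam : ℝ) (hp : 1 ≤ p) (hlam : 0 ≤ lam) (hlam' : lam ≤ 4) :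
    Nonempty ((invariantGaugeGroup π ⧸ basedGaugeGroup π (q (f₀, e0))) ≃*
      Multiplicative (ZMod 2)) ∧
    @IsHomeomorph _ _ (basedOrbitTopology π (q (f₀, e0)) k p lam) (orbitTopology π k p lam)
      (orbitProj π (q (f₀, e0))) := by
  have hπ := (inferInstance : IsEquivariantSU2Bundle π).out
  obtain ⟨y, hy⟩ := hQ.bundle.surjective (q (f₀, e0))
  obtain ⟨s, t, hs, ht, hst⟩ := hQ.exists_anticommuting hq hf₀ hy
  have H := xor_mem_basedGaugeGroup π (p₀ := r y) ((hP.proj y).trans hy) fun φ u hu => by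
    -- Evaluating `φ (h • r y)` through the left action and through the right action shows that `u`
    -- commutes with the isotropy representation on the spinor bundle.
    have hcomm : ∀ (h : SU2) (z : Spin4), h • y = MulOpposite.op z • y →
        halfSpin c z * u = u * halfSpin c z := by
      intro h z hz
      have hz' : h • r y = MulOpposite.op (halfSpin c z) • r y := by
        rw [← hP.left, hz, hP.right]
      have h1 : (φ : Equiv.Perm P) (h • r y) =
          MulOpposite.op (halfSpin c z * u) • r y := by
        rw [φ.2.2.2.2.2, hu]
        rw [hπ.comm, hz', op_smul_op_smul_SU2]
      have h2 : (φ : Equiv.Perm P) (h • r y) =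
          MulOpposite.op (u * halfSpin c z) • r y := by
        rw [hz', φ.2.2.2.2.1, hu, op_smul_op_smul_SU2]
      exact hπ.smul_injective (h1.symm.trans h2)
    -- Both half-spin representations send `(-1, -1)` to `-1`, so anticommutation survives in either
    -- chirality.
    have hneg : halfSpin c (-1, -1) = -1 := by cases c <;> rfl
    refine eq_one_or_neg_one_of_commute ?_ (hcomm _ s hs) (hcomm _ t ht)
    rw [← map_mul, hst, map_mul, map_mul, hneg]
  exact ⟨nonempty_quotient_mulEquiv_of_xor _ _ H,
    isHomeomorph_orbitProj π _ k p lam (orbitProj_bijective π _ H)⟩
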